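/- For a probability distribution $\mu$ on $\mathbb R$ and $\tau\in(0,1)$ let $\mathrm{CVaR}_\tau(\mu)=\sup_{b\in\mathbb R}\bigl(b-\tau^{-1}\,\mathbb E_{X\sim\mu}[(b-X)^+]\bigr)$. A multi-armed bandit instance with $A$ arms is a family $\nu=(\nu(a))_{a\in[A]}$ of reward distributions on $\mathbb R$; it has Bernoulli rewards if every $\nu(a)$ is a Bernoulli distribution $\mathrm{Ber}(p_a)$ on $\{0,1\}$ with $p_a\in[0,1]$. A bandit algorithm chooses in each episode $k=1,2,\dots$ an arm $a_k\in[A]$, possibly at random, on the basis of the past $(a_1,r_1,\dots,a_{k-1},r_{k-1})$, and then observes a reward $r_k\sim\nu(a_k)$ which, given $a_k$, is independent of the past. Its regret over $K$ episodes is $$\mathrm{Regret}_\tau(K)=\sum_{k=1}^{K}\Bigl(\max_{a\in[A]}\mathrm{CVaR}_\tau(\nu(a))-\mathrm{CVaR}_\tau(\nu(a_k))\Bigr).$$ Theorem. Let $\tau\in(0,1/2)$, let $A\ge 1$ be an integer, and let $K$ be a nonnegative integer with $K\ge \frac{A-1}{8\tau}$. Then for every bandit algorithm with $A$ arms (which may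 depend on $\tau$, $A$ and $K$) there is a bandit instance with $A$ arms and Bernoulli rewards on which the expected regret of the algorithm satisfies $$\mathbb E[\mathrm{Regret}_\tau(K)]\ \ge\ \frac{1}{24e}\sqrt{\frac{(A-1)K}{\tau}} .$$ -/

import Mathlib

open MeasureTheory ProbabilityTheory

noncomputable section

/-- Conditional value at risk (for returns, higher is better) with risk tolerance `τ` of a
distribution `μ` on `ℝ`: `sup_{b ∈ ℝ} (b - τ⁻¹ E_{X ∼ μ}[(b - X)⁺])`. -/
def cvar (τ : ℝ) (μ : Measure ℝ) : ℝ :=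
  ⨆ b : ℝ, (b - τ⁻¹ * ∫ x, max (b - x) 0 ∂μ)

/-- The history of the first `k` episodes of a bandit with `A` arms: the pulled arm and the
observed reward in each of these episodes. -/
abbrev BanditHistory (A k : ℕ) : Type := Fin k → Fin A × ℝ

/-- A (possibly randomized) bandit algorithm for `A` arms: after `k` episodes it draws the next arm
from a distribution depending measurably on the whole history of these episodes. -/
structure BanditAlgorithm (A : ℕ) where
  policy : (k : ℕ) → Kernel (BanditHistory A k) (Fin A)
  isMarkovKernel_policy : ∀ k, IsMarkovKernel (policy k)

/-- A bandit instance with `A` arms: the reward distribution of each arm. -/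
abbrev BanditInstance (A : ℕ) : Type := Fin A → ProbabilityMeasure ℝ

/-- The reward distributions of a bandit instance as a kernel from arms to rewards. -/
def BanditInstance.rewardKernel {A : ℕ} (ν : BanditInstance A) : Kernel (Fin A) ℝ :=
  Kernel.ofFunOfCountable fun a => (ν a : Measure ℝ)

/-- The law of the history of the first `k` episodes when `alg` is run on `ν`. Given the history `h`
of the first `k` episodes, the next arm has law `alg.policy k h`, and given `h` and that arm `a`,
the next reward has law `ν a`; the new pair is appended to `h`. -/
def banditLaw {A : ℕ} (ν : BanditInstance A) (alg : BanditAlgorithm A) :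
    (k : ℕ) → Measure (BanditHistory A k)
  | 0 => Measure.dirac Fin.elim0
  | k + 1 =>
    (banditLaw ν alg k ⊗ₘ
        (alg.policy k ⊗ₖ Kernel.prodMkLeft (BanditHistory A k) ν.rewardKernel)).map
      fun q => (Fin.snoc q.1 q.2 : BanditHistory A (k + 1))

/-- The `CVaR_τ` regret of a history `h` of `K` episodes:
`∑_k (max_a CVaR_τ(ν a) - CVaR_τ(ν a_k))`, with `a_k` the arm pulled in episode `k`. -/
def cvarRegret {A K : ℕ} (τ : ℝ) (ν : BanditInstance A) (h : BanditHistory A K) : ℝ :=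
  ∑ k : Fin K, ((⨆ a : Fin A, cvar τ (ν a : Measure ℝ)) - cvar τ (ν (h k).1 : Measure ℝ))

/-- The expected `CVaR_τ` regret over `K` episodes of `alg` on `ν`. -/
def expectedCvarRegret {A : ℕ} (τ : ℝ) (K : ℕ) (ν : BanditInstance A) (alg : BanditAlgorithm A) :
    ℝ :=
  ∫ h, cvarRegret τ ν h ∂(banditLaw ν alg K)

/-- The bandit instance in which the reward of arm `a` is `1` with probability `p a` and `0`
otherwise. -/
def bernoulliBandit {A : ℕ} (p : Fin A → unitInterval) : BanditInstance A :=
  fun a => ⟨bernoulliMeasure (1 : ℝ) 0 (p a), inferInstance⟩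

end

/-!
The argument is the two-instance method for bandit lower bounds. If `Ber(1 - q)` has `q ≤ τ`, its
`CVaR` at level `τ` is `1 - q / τ` (`cvar_bernoulliMeasure`), so lowering `q` from `τ` by `x` gains
`x / τ` in `CVaR`, while the information that a single pull yields about this change is only of
order `x ^ 2 / τ`.

In the first instance every arm fails with probability `τ`, except for a distinguished arm `a₀`,
which fails with probability `τ - ε`. Some arm `i ≠ a₀` is pulled at most `K / (A - 1)` times in
expectation (`exists_expectedPulls_le`). The second instance differs from the first in this arm
only, which now fails with probability `τ - 2 ε`. An episode which pulls another arm than `a₀` costs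
`ε / τ` on the first instance, and an episode which pulls `a₀` costs `ε / τ` on the second, so the
two regrets add up to at least `(ε / τ) K` times the overlap of the two laws of the history
(`mul_sum_min_le_add_expectedCvarRegret`). By the Bretagnolle–Huber inequality
(`exp_sum_mul_le_two_mul_sum_min`) the overlap is at least half the exponential of minus the relative
entropy, which by the chain rule is the expected number of pulls of `i` times the relative entropy
of the two Bernoulli distributions (`exp_neg_mul_expectedPulls_le`). With
`ε = √(τ (A - 1) / K) / 8` that exponent is at most `1 / 2`, and one of the two instances has at
least half of the total regret.

Bernoulli rewards take two values only, so the law of the history is a finite sum of point masses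
(`banditLaw_bernoulliBandit`), and all expectations are finite sums over sequences of arms and
binary rewards.
-/

/-! ### The law of the outcomes under Bernoulli rewards -/

/-- The mass that the Bernoulli distribution with success probability `p` gives to an outcome. -/
def bernoulliWeight (p : ℝ) (r : Bool) : ℝ := if r then p else 1 - p

lemma bernoulliWeight_nonneg (p : unitInterval) (r : Bool) : 0 ≤ bernoulliWeight p r := by
  cases r
  · simpa [bernoulliWeight] using p.2.2
  · simpa [bernoulliWeight] using p.2.1

lemma sum_bernoulliWeight (p : ℝ) : ∑ r, bernoulliWeight p r = 1 := by
  simp [bernoulliWeight]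

/-- The history with rewards in `ℝ` that a sequence of arms and binary rewards stands for. -/
noncomputable def realHistory {A k : ℕ} (ω : Fin k → Fin A × Bool) : BanditHistory A k :=
  fun j => ((ω j).1, if (ω j).2 then 1 else 0)

/-- The probability that `alg`, run on the bandit with Bernoulli parameters `p`, produces the
sequence `ω` of arms and binary rewards. -/
noncomputable def outcomeWeight {A : ℕ} (alg : BanditAlgorithm A) (p : Fin A → unitInterval) :
    (k : ℕ) → (Fin k → Fin A × Bool) → ℝ
  | 0, _ => 1
  | k + 1, ω =>
    outcomeWeight alg p k (Fin.init ω) *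
      ((alg.policy k (realHistory (Fin.init ω))).real {(ω (Fin.last k)).1} *
        bernoulliWeight (p (ω (Fin.last k)).1) (ω (Fin.last k)).2)

lemma sum_fin_succ_arrow {α M : Type*} [Fintype α] [AddCommMonoid M] {k : ℕ}
    (F : (Fin (k + 1) → α) → M) :
    ∑ ω, F ω = ∑ ω : Fin k → α, ∑ x, F (Fin.snoc ω x) := by
  rw [← (Fin.snocEquiv fun _ => α).sum_comp, Fintype.sum_prod_type_right]
  rfl

lemma realHistory_snoc {A k : ℕ} (ω : Fin k → Fin A × Bool) (x : Fin A × Bool) :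
    realHistory (Fin.snoc ω x : Fin (k + 1) → Fin A × Bool) =
      (Fin.snoc (realHistory ω) (x.1, if x.2 then 1 else 0) : BanditHistory A (k + 1)) := by
  funext j
  refine Fin.lastCases ?_ (fun i => ?_) j <;> simp [realHistory]

section Outcomes

variable {A : ℕ} (alg : BanditAlgorithm A) (p : Fin A → unitInterval)

lemma outcomeWeight_snoc {k : ℕ} (ω : Fin k → Fin A × Bool) (x : Fin A × Bool) :
    outcomeWeight alg p (k + 1) (Fin.snoc ω x) = outcomeWeight alg p k ω *
      ((alg.policy k (realHistory ω)).real {x.1} * bernoulliWeight (p x.1) x.2) := by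
  simp [outcomeWeight]

lemma outcomeWeight_nonneg (k : ℕ) (ω : Fin k → Fin A × Bool) : 0 ≤ outcomeWeight alg p k ω := by
  induction k with
  | zero => simp [outcomeWeight]
  | succ k ih =>
    exact mul_nonneg (ih _) (mul_nonneg measureReal_nonneg (bernoulliWeight_nonneg _ _))

lemma sum_policy (k : ℕ) (h : BanditHistory A k) : ∑ a, (alg.policy k h).real {a} = 1 := by
  have := alg.isMarkovKernel_policy k
  rw [sum_measureReal_singleton]
  simp

lemma sum_outcomeWeight (k : ℕ) : ∑ ω, outcomeWeight alg p k ω = 1 := by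
  induction k with
  | zero => simp [outcomeWeight]
  | succ k ih =>
    simp_rw [sum_fin_succ_arrow, outcomeWeight_snoc, Fintype.sum_prod_type, ← Finset.mul_sum,
      sum_bernoulliWeight, mul_one, sum_policy, mul_one, ih]

/-- The tower property for additive functionals: the reward of each episode may be averaged out
given the arm pulled in that episode. -/
lemma sum_outcomeWeight_mul_sum (f : Fin A × Bool → ℝ) (k : ℕ) :
    ∑ ω, outcomeWeight alg p k ω * ∑ j, f (ω j) =
      ∑ ω, outcomeWeight alg p k ω *
        ∑ j, ∑ r, bernoulliWeight (p (ω j).1) r * f ((ω j).1, r) := by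
  induction k with
  | zero => simp
  | succ k ih =>
    have key (g : Fin A × Bool → ℝ) : ∑ ω, outcomeWeight alg p (k + 1) ω * ∑ j, g (ω j) =
        ∑ ω, outcomeWeight alg p k ω * ∑ j, g (ω j) + ∑ ω, outcomeWeight alg p k ω *
          ∑ a, (alg.policy k (realHistory ω)).real {a} *
            ∑ r, bernoulliWeight (p a) r * g (a, r) := by
      rw [sum_fin_succ_arrow, ← Finset.sum_add_distrib]
      refine Finset.sum_congr rfl fun ω _ => ?_
      simp_rw [outcomeWeight_snoc, Fin.sum_univ_castSucc, Fin.snoc_castSucc, Fin.snoc_last,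
        Fintype.sum_prod_type, mul_add, Finset.sum_add_distrib]
      congr 1
      · simp_rw [← Finset.sum_mul, ← Finset.mul_sum, sum_bernoulliWeight, mul_one, sum_policy,
          mul_one]
      · simp_rw [Finset.mul_sum, mul_assoc]
    rw [key f, key fun x => ∑ r, bernoulliWeight (p x.1) r * f (x.1, r), ih]
    simp_rw [← Finset.sum_mul, sum_bernoulliWeight, one_mul]

/-- The law of the history under Bernoulli rewards is a finite sum of point masses. -/
lemma banditLaw_bernoulliBandit (k : ℕ) :
    banditLaw (bernoulliBandit p) alg k =
      ∑ ω, ENNReal.ofReal (outcomeWeight alg p k ω) • Measure.dirac (realHistory ω) := by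
  induction k with
  | zero =>
    simp [banditLaw, outcomeWeight]
    congr 1
    exact Subsingleton.elim _ _
  | succ k ih =>
    have := alg.isMarkovKernel_policy k
    have : IsMarkovKernel (bernoulliBandit p).rewardKernel :=
      ⟨fun a => inferInstanceAs (IsProbabilityMeasure (bernoulliBandit p a : Measure ℝ))⟩
    have hsnoc : Measurable fun q : BanditHistory A k × (Fin A × ℝ) =>
        (Fin.snoc q.1 q.2 : BanditHistory A (k + 1)) := by
      refine measurable_pi_iff.2 fun j => ?_
      refine Fin.lastCases ?_ (fun i => ?_) j
      · simpa using measurable_snd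
      · simpa using measurable_fst.eval
    have hfin : SFinite (∑ ω : Fin k → Fin A × Bool,
        ENNReal.ofReal (outcomeWeight alg p k ω) • Measure.dirac (realHistory ω)) := by
      rw [← Measure.sum_fintype]
      infer_instance
    ext s hs
    have hs' := hsnoc hs
    rw [banditLaw, ih, Measure.map_apply hsnoc hs, Measure.compProd_apply hs',
      lintegral_finsetSum_measure]
    simp only [lintegral_smul_measure, lintegral_dirac, Measure.coe_finsetSum, Finset.sum_apply,
      Measure.smul_apply]
    rw [sum_fin_succ_arrow]
    refine Finset.sum_congr rfl fun ω _ => ?_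
    rw [Kernel.compProd_apply (measurable_prodMk_left hs'), lintegral_fintype,
      Fintype.sum_prod_type, Finset.smul_sum]
    refine Finset.sum_congr rfl fun a _ => ?_
    have hν : (bernoulliBandit p).rewardKernel a = bernoulliMeasure (1 : ℝ) 0 (p a) := rfl
    have hp : ENNReal.ofReal ((alg.policy k (realHistory ω)).real {a}) =
        alg.policy k (realHistory ω) {a} := ofReal_measureReal
    have hw := outcomeWeight_nonneg alg p k ω
    have h1 : (unitInterval.toNNReal (p a) : ENNReal) = ENNReal.ofReal (p a) := by
      rw [ENNReal.ofReal, ← Real.toNNReal_coe (r := unitInterval.toNNReal (p a))]; rfl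
    have h0 : (unitInterval.toNNReal (unitInterval.symm (p a)) : ENNReal) =
        ENNReal.ofReal (1 - p a) := by
      rw [ENNReal.ofReal,
        ← Real.toNNReal_coe (r := unitInterval.toNNReal (unitInterval.symm (p a)))]
      rfl
    simp only [Kernel.prodMkLeft_apply, hν, outcomeWeight_snoc, realHistory_snoc,
      bernoulliMeasure_def, Fintype.sum_bool, bernoulliWeight, Measure.add_apply,
      Measure.smul_apply, if_true, Bool.false_eq_true, if_false, smul_eq_mul, ENNReal.smul_def,
      Measure.dirac_apply, h1, h0, ENNReal.ofReal_mul hw, ENNReal.ofReal_mul measureReal_nonneg, hp]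
    have hr (r : ℝ) : (Prod.mk a ⁻¹' (Prod.mk (realHistory ω) ⁻¹' ((fun q :
        BanditHistory A k × (Fin A × ℝ) => (Fin.snoc q.1 q.2 : BanditHistory A (k + 1))) ⁻¹' s))
          ).indicator (1 : ℝ → ENNReal) r =
        s.indicator 1 (Fin.snoc (realHistory ω) (a, r) : BanditHistory A (k + 1)) := rfl
    rw [hr, hr]
    ring

end Outcomes

/-! ### The `CVaR` of Bernoulli distributions -/

/-- If `0` has mass at most `τ`, the supremum defining the `CVaR` is attained at `b = 1`. -/
lemma cvar_bernoulliMeasure {τ : ℝ} (hτ : 0 < τ) (hτ' : τ ≤ 1) (p : unitInterval)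
    (hp : 1 - (p : ℝ) ≤ τ) :
    cvar τ (bernoulliMeasure (1 : ℝ) 0 p) = 1 - (1 - p) / τ := by
  have hint (b : ℝ) : b - τ⁻¹ * ∫ x, max (b - x) 0 ∂(bernoulliMeasure (1 : ℝ) 0 p) =
      b - (p * max (b - 1) 0 + (1 - p) * max b 0) / τ := by
    rw [integral_bernoulliMeasure]
    simp [div_eq_inv_mul]
  unfold cvar
  simp_rw [hint]
  have hp0 : 0 ≤ (p : ℝ) := p.2.1
  have hp1 : (p : ℝ) ≤ 1 := p.2.2
  have hub (b : ℝ) : b - (p * max (b - 1) 0 + (1 - p) * max b 0) / τ ≤ 1 - (1 - p) / τ := by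
    rw [← sub_nonneg]
    have : 1 - (1 - p) / τ - (b - (p * max (b - 1) 0 + (1 - p) * max b 0) / τ) =
      ((1 - b) * τ - (1 - p) + p * max (b - 1) 0 + (1 - p) * max b 0) / τ := by field_simp; ring
    rw [this]
    refine div_nonneg ?_ hτ.le
    rcases le_total b 0 with h | h
    · rw [max_eq_right h, max_eq_right (by linarith)]
      nlinarith
    rcases le_total b 1 with h' | h'
    · rw [max_eq_left h, max_eq_right (by linarith)]
      nlinarith
    · rw [max_eq_left h, max_eq_left (by linarith)]
      nlinarith
  refine le_antisymm (ciSup_le hub) ?_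
  refine le_trans (le_of_eq ?_) (le_ciSup ⟨_, Set.forall_mem_range.2 hub⟩ 1)
  simp

/-! ### The Bretagnolle–Huber inequality -/

/-- The **Bretagnolle–Huber inequality** for finitely supported distributions: if `v` has density
`exp L` with respect to `w`, then the overlap of `w` and `v` is at least half the exponential of
minus the relative entropy of `w` with respect to `v`. -/
lemma exp_sum_mul_le_two_mul_sum_min {ι : Type*} [Fintype ι] {w v L : ι → ℝ} (hw : ∀ x, 0 ≤ w x)
    (hw1 : ∑ x, w x = 1) (hv1 : ∑ x, v x = 1) (hv : ∀ x, v x = w x * Real.exp (L x)) :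
    Real.exp (∑ x, w x * L x) ≤ 2 * ∑ x, min (w x) (v x) := by
  have hv0 (x) : 0 ≤ v x := by rw [hv]; exact mul_nonneg (hw x) (Real.exp_pos _).le
  have hjensen : Real.exp (∑ x, w x * (L x / 2)) ≤ ∑ x, w x * Real.exp (L x / 2) := by
    have := convexOn_exp.map_sum_le (t := Finset.univ) (w := w) (p := fun x => L x / 2)
      (fun x _ => hw x) hw1 (fun _ _ => Set.mem_univ _)
    simpa using this
  -- The geometric mean of `w` and `v` equals that of their minimum and maximum.
  have hroot (x) : w x * Real.exp (L x / 2) = √(min (w x) (v x)) * √(max (w x) (v x)) := by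
    rw [← Real.sqrt_mul (le_min (hw x) (hv0 x)), min_mul_max, hv, ← mul_assoc,
      Real.sqrt_mul (mul_self_nonneg _), Real.sqrt_mul_self (hw x), Real.exp_half]
  have hcs := Finset.sum_mul_sq_le_sq_mul_sq Finset.univ (fun x => √(min (w x) (v x)))
    (fun x => √(max (w x) (v x)))
  simp_rw [← hroot, Real.sq_sqrt (le_min (hw _) (hv0 _)),
    Real.sq_sqrt (le_max_of_le_left (hw _))] at hcs
  have hmax : ∑ x, max (w x) (v x) ≤ 2 := by
    calc ∑ x, max (w x) (v x) ≤ ∑ x, (w x + v x) := Finset.sum_le_sum fun x _ =>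
          max_le_add_of_nonneg (hw x) (hv0 x)
      _ = 2 := by rw [Finset.sum_add_distrib, hw1, hv1]; norm_num
  have hmin : 0 ≤ ∑ x, min (w x) (v x) := Finset.sum_nonneg fun x _ => le_min (hw x) (hv0 x)
  calc Real.exp (∑ x, w x * L x) = Real.exp (∑ x, w x * (L x / 2)) ^ 2 := by
        rw [← Real.exp_nat_mul, Finset.mul_sum]
        congr 1
        exact Finset.sum_congr rfl fun x _ => by push_cast; ring
    _ ≤ (∑ x, w x * Real.exp (L x / 2)) ^ 2 := by gcongr
    _ ≤ _ := hcs
    _ ≤ _ := by rw [mul_comm]; gcongr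

/-! ### Likelihood ratios and regret -/

section Comparison

variable {A : ℕ} (alg : BanditAlgorithm A)

/-- The expected regret under Bernoulli rewards is a finite weighted sum. -/
lemma expectedCvarRegret_bernoulliBandit (τ : ℝ) (K : ℕ) (p : Fin A → unitInterval) :
    expectedCvarRegret τ K (bernoulliBandit p) alg = ∑ ω : Fin K → Fin A × Bool,
      outcomeWeight alg p K ω * ∑ j, ((⨆ a, cvar τ (bernoulliMeasure (1 : ℝ) 0 (p a))) -
        cvar τ (bernoulliMeasure (1 : ℝ) 0 (p (ω j).1))) := by
  rw [expectedCvarRegret, banditLaw_bernoulliBandit, integral_finsetSum_measure]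
  · refine Finset.sum_congr rfl fun ω _ => ?_
    rw [integral_smul_measure, integral_dirac, smul_eq_mul,
      ENNReal.toReal_ofReal (outcomeWeight_nonneg ..)]
    rfl
  · intro ω _
    exact (integrable_dirac (by simp)).smul_measure ENNReal.ofReal_ne_top

/-- Changing the instance multiplies the law of the outcomes by the product of the
likelihood ratios of the single rewards. -/
lemma outcomeWeight_eq_mul_exp {p p' : Fin A → unitInterval}
    (hp : ∀ a r, 0 < bernoulliWeight (p a) r) (hp' : ∀ a r, 0 < bernoulliWeight (p' a) r)
    (k : ℕ) (ω : Fin k → Fin A × Bool) :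
    outcomeWeight alg p' k ω = outcomeWeight alg p k ω * Real.exp (∑ j, Real.log
      (bernoulliWeight (p' (ω j).1) (ω j).2 / bernoulliWeight (p (ω j).1) (ω j).2)) := by
  induction k with
  | zero => simp [outcomeWeight]
  | succ k ih =>
    rw [outcomeWeight, outcomeWeight, ih, Fin.sum_univ_castSucc, Real.exp_add,
      Real.exp_log (div_pos (hp' _ _) (hp _ _))]
    have := (hp (ω (Fin.last k)).1 (ω (Fin.last k)).2).ne'
    simp only [Fin.init]
    field_simp

/-- The relative entropy of two Bernoulli distributions is at most their `χ²`-divergence. -/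
lemma neg_chiSq_le_sum_bernoulliWeight_mul_log {τ δ : ℝ} (hτ : τ < 1) (hδ : 0 ≤ δ)
    (hδτ : δ < τ) :
    -(δ ^ 2 / ((τ - δ) * (1 - τ + δ))) ≤ ∑ r, bernoulliWeight (1 - τ) r *
      Real.log (bernoulliWeight (1 - (τ - δ)) r / bernoulliWeight (1 - τ) r) := by
  have h1 := Real.one_sub_inv_le_log_of_pos (x := (1 - τ + δ) / (1 - τ))
    (div_pos (by linarith) (by linarith))
  have h2 := Real.one_sub_inv_le_log_of_pos (x := (τ - δ) / τ)
    (div_pos (by linarith) (by linarith))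
  have h1' := mul_le_mul_of_nonneg_left h1 (by linarith : 0 ≤ 1 - τ)
  have h2' := mul_le_mul_of_nonneg_left h2 (by linarith : 0 ≤ τ)
  simp only [bernoulliWeight, Fintype.sum_bool, if_true, Bool.false_eq_true, if_false,
    sub_sub_cancel]
  rw [show 1 - (τ - δ) = 1 - τ + δ by ring]
  refine le_trans (le_of_eq ?_) (add_le_add h1' h2')
  have : τ - δ ≠ 0 := by linarith
  have : 1 - τ + δ ≠ 0 := by linarith
  rw [inv_div, inv_div]
  field_simp
  ring

/-- The expected number of times that arm `a` is pulled in the first `k` episodes. -/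
noncomputable def expectedPulls (p : Fin A → unitInterval) (k : ℕ) (a : Fin A) : ℝ :=
  ∑ ω, outcomeWeight alg p k ω * ∑ j, if (ω j).1 = a then 1 else 0

lemma expectedPulls_nonneg (p : Fin A → unitInterval) (k : ℕ) (a : Fin A) :
    0 ≤ expectedPulls alg p k a :=
  Finset.sum_nonneg fun _ _ => mul_nonneg (outcomeWeight_nonneg ..)
    (Finset.sum_nonneg fun _ _ => by positivity)

/-- Among the arms other than `a₀`, some arm is pulled at most as often as the average allows. -/
lemma exists_expectedPulls_le (p : Fin A → unitInterval) (k : ℕ) (a₀ : Fin A) (hA : 2 ≤ A) :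
    ∃ i ≠ a₀, ((A : ℝ) - 1) * expectedPulls alg p k i ≤ k := by
  have hcard : ((Finset.univ.erase a₀).card : ℝ) = (A : ℝ) - 1 := by
    rw [Finset.card_erase_of_mem (Finset.mem_univ _)]
    simp [Nat.cast_sub (by omega : 1 ≤ A)]
  have hA' : (2 : ℝ) ≤ A := by exact_mod_cast hA
  have htot : ∑ i, expectedPulls alg p k i = k := by
    simp only [expectedPulls]
    rw [Finset.sum_comm]
    simp_rw [← Finset.mul_sum]
    have (ω : Fin k → Fin A × Bool) :
        ∑ i, ∑ j, (if (ω j).1 = i then (1 : ℝ) else 0) = k := by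
      rw [Finset.sum_comm]; simp
    simp_rw [this, ← Finset.sum_mul, sum_outcomeWeight, one_mul]
  by_contra! h
  have hlt : ∑ i ∈ Finset.univ.erase a₀, (k : ℝ) <
      ∑ i ∈ Finset.univ.erase a₀, ((A : ℝ) - 1) * expectedPulls alg p k i := by
    refine Finset.sum_lt_sum_of_nonempty ?_ fun i hi => h i (Finset.ne_of_mem_erase hi)
    rw [← Finset.card_pos, ← Nat.cast_pos (α := ℝ), hcard]
    linarith
  rw [Finset.sum_const, nsmul_eq_mul, hcard, ← Finset.mul_sum] at hlt
  have := Finset.add_sum_erase Finset.univ (expectedPulls alg p k) (Finset.mem_univ a₀)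
  nlinarith [expectedPulls_nonneg alg p k a₀]

end Comparison

section TwoInstances

variable {A : ℕ} (alg : BanditAlgorithm A)

/-- Two instances that differ in arm `i` only are hard to tell apart if `alg` rarely pulls `i` on
the first of them: the relative entropy of the two laws is the expected number of pulls of `i`
times the relative entropy of the two reward distributions of `i`. -/
lemma exp_neg_mul_expectedPulls_le {p p' : Fin A → unitInterval} {τ δ : ℝ} (hτ : τ < 1)
    (hδ : 0 ≤ δ) (hδτ : δ < τ) (hp : ∀ a r, 0 < bernoulliWeight (p a) r)
    (hp' : ∀ a r, 0 < bernoulliWeight (p' a) r) {i : Fin A} (hpi : (p i : ℝ) = 1 - τ)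
    (hpi' : (p' i : ℝ) = 1 - (τ - δ)) (hne : ∀ a ≠ i, p' a = p a) (k : ℕ) :
    Real.exp (-(δ ^ 2 / ((τ - δ) * (1 - τ + δ)) * expectedPulls alg p k i)) ≤
      2 * ∑ ω, min (outcomeWeight alg p k ω) (outcomeWeight alg p' k ω) := by
  refine le_trans (Real.exp_le_exp.2 ?_) (exp_sum_mul_le_two_mul_sum_min
    (outcomeWeight_nonneg alg p k) (sum_outcomeWeight alg p k) (sum_outcomeWeight alg p' k)
    (outcomeWeight_eq_mul_exp alg hp hp' k))
  rw [sum_outcomeWeight_mul_sum alg p (fun x => Real.log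
    (bernoulliWeight (p' x.1) x.2 / bernoulliWeight (p x.1) x.2)), expectedPulls, ← neg_mul,
    Finset.mul_sum]
  refine Finset.sum_le_sum fun ω _ => ?_
  rw [mul_left_comm, Finset.mul_sum]
  refine mul_le_mul_of_nonneg_left (Finset.sum_le_sum fun j _ => ?_) (outcomeWeight_nonneg ..)
  by_cases h : (ω j).1 = i
  · simpa only [h, if_true, mul_one, hpi, hpi'] using
      neg_chiSq_le_sum_bernoulliWeight_mul_log hτ hδ hδτ
  · simp [h, hne _ h, div_self (hp _ _).ne']

/-- If pulling `a₀` is optimal on `p` by a margin `Δ`, while on `p'` it costs at least `Δ`, then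
the two regrets add up to at least `Δ K` times the overlap of the two laws. -/
lemma mul_sum_min_le_add_expectedCvarRegret {τ Δ : ℝ} {p p' : Fin A → unitInterval} {a₀ i : Fin A}
    (h : ∀ a ≠ a₀, cvar τ (bernoulliMeasure (1 : ℝ) 0 (p a)) + Δ ≤
      cvar τ (bernoulliMeasure (1 : ℝ) 0 (p a₀)))
    (h' : cvar τ (bernoulliMeasure (1 : ℝ) 0 (p' a₀)) + Δ ≤
      cvar τ (bernoulliMeasure (1 : ℝ) 0 (p' i))) (K : ℕ) :
    Δ * K * ∑ ω, min (outcomeWeight alg p K ω) (outcomeWeight alg p' K ω) ≤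
      expectedCvarRegret τ K (bernoulliBandit p) alg +
        expectedCvarRegret τ K (bernoulliBandit p') alg := by
  rw [expectedCvarRegret_bernoulliBandit, expectedCvarRegret_bernoulliBandit,
    ← Finset.sum_add_distrib, Finset.mul_sum]
  refine Finset.sum_le_sum fun ω _ => ?_
  have hsup (q : Fin A → unitInterval) (a : Fin A) : cvar τ (bernoulliMeasure (1 : ℝ) 0 (q a)) ≤
      ⨆ a, cvar τ (bernoulliMeasure (1 : ℝ) 0 (q a)) :=
    le_ciSup (f := fun a => cvar τ (bernoulliMeasure (1 : ℝ) 0 (q a)))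
      (Set.finite_range _).bddAbove a
  have hw := outcomeWeight_nonneg alg p K ω
  have hw' := outcomeWeight_nonneg alg p' K ω
  have hmin := le_min hw hw'
  have hnn (q : Fin A → unitInterval) (j : Fin K) :
      0 ≤ (⨆ a, cvar τ (bernoulliMeasure (1 : ℝ) 0 (q a))) -
        cvar τ (bernoulliMeasure (1 : ℝ) 0 (q (ω j).1)) := sub_nonneg.2 (hsup q _)
  calc Δ * K * min (outcomeWeight alg p K ω) (outcomeWeight alg p' K ω)
      = min (outcomeWeight alg p K ω) (outcomeWeight alg p' K ω) * ∑ j : Fin K, Δ := by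
        simp; ring
    _ ≤ min (outcomeWeight alg p K ω) (outcomeWeight alg p' K ω) *
        ∑ j, (((⨆ a, cvar τ (bernoulliMeasure (1 : ℝ) 0 (p a))) -
          cvar τ (bernoulliMeasure (1 : ℝ) 0 (p (ω j).1))) +
          ((⨆ a, cvar τ (bernoulliMeasure (1 : ℝ) 0 (p' a))) -
          cvar τ (bernoulliMeasure (1 : ℝ) 0 (p' (ω j).1)))) := by
        refine mul_le_mul_of_nonneg_left (Finset.sum_le_sum fun j _ => ?_) hmin
        by_cases hj : (ω j).1 = a₀
        · have := hnn p j
          rw [hj] at this ⊢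
          linarith [hsup p' i]
        · linarith [hnn p' j, h _ hj, hsup p a₀]
    _ ≤ _ := by
        rw [Finset.sum_add_distrib, mul_add]
        exact add_le_add
          (mul_le_mul_of_nonneg_right (min_le_left _ _) (Finset.sum_nonneg fun j _ => hnn p j))
          (mul_le_mul_of_nonneg_right (min_le_right _ _) (Finset.sum_nonneg fun j _ => hnn p' j))

end TwoInstances

/-! ### The lower bound -/

theorem mainTheorem1 (τ : ℝ) (hτ : τ ∈ Set.Ioo (0 : ℝ) (1 / 2)) (A : ℕ) (hA : 1 ≤ A)
    (K : ℕ) (hK : ((A : ℝ) - 1) / (8 * τ) ≤ (K : ℝ)) (alg : BanditAlgorithm A) :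
    ∃ p : Fin A → unitInterval,
      1 / (24 * Real.exp 1) * Real.sqrt (((A : ℝ) - 1) * K / τ) ≤
        expectedCvarRegret τ K (bernoulliBandit p) alg := by
  obtain ⟨hτ0, hτ2⟩ := hτ
  obtain rfl | hA2 := hA.eq_or_lt
  -- With a single arm, both sides vanish.
  · refine ⟨fun _ => 0, ?_⟩
    simp [expectedCvarRegret_bernoulliBandit]
  have hA1 : (1 : ℝ) ≤ (A : ℝ) - 1 := by
    have : (2 : ℝ) ≤ A := by exact_mod_cast hA2
    linarith
  rw [div_le_iff₀ (by positivity)] at hK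
  have hK0 : 0 < (K : ℝ) := by
    by_contra! h
    nlinarith
  set s := √(((A : ℝ) - 1) * K / τ) with hs
  have hs2 : s ^ 2 = ((A : ℝ) - 1) * K / τ := Real.sq_sqrt (by positivity)
  have hs0 : 0 ≤ s := Real.sqrt_nonneg _
  -- `ε ^ 2` is of the order `τ (A - 1) / K`, so that the `K / (A - 1)` pulls of a rarely pulled arm
  -- carry only a bounded amount of information on a change of its parameter by `2 ε`.
  set ε := τ * s / (8 * K) with hε
  have hε0 : 0 ≤ ε := by positivity
  have hε2 : ε ^ 2 = τ * ((A : ℝ) - 1) / (64 * K) := by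
    rw [hε, div_pow, mul_pow, hs2]; field_simp; norm_num
  -- This is where `K` has to be at least `(A - 1) / (8 τ)`.
  have hετ : 2 * ε ≤ 3 / 4 * τ := by
    have : (2 * ε) ^ 2 ≤ (3 / 4 * τ) ^ 2 := by
      have : ε ^ 2 ≤ τ ^ 2 / 8 := by
        rw [hε2, div_le_iff₀ (by positivity)]
        nlinarith
      nlinarith
    exact le_of_sq_le_sq this (by positivity)
  have hmem {q : ℝ} (h0 : τ / 4 ≤ q) (h1 : q ≤ τ) : 1 - q ∈ unitInterval :=
    ⟨by linarith, by linarith⟩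
  let a₀ : Fin A := ⟨0, by omega⟩
  let p : Fin A → unitInterval := fun a =>
    if a = a₀ then ⟨1 - (τ - ε), hmem (by linarith) (by linarith)⟩
    else ⟨1 - τ, hmem (by linarith) le_rfl⟩
  obtain ⟨i, hi, hpulls⟩ := exists_expectedPulls_le alg p K a₀ hA2
  let p' : Fin A → unitInterval :=
    Function.update p i ⟨1 - (τ - 2 * ε), hmem (by linarith) (by linarith)⟩
  have hp₀ : (p a₀ : ℝ) = 1 - (τ - ε) := by simp [p]
  have hp₁ (a) (ha : a ≠ a₀) : (p a : ℝ) = 1 - τ := by simp [p, ha]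
  have hp' (a) (ha : a ≠ i) : p' a = p a := by simp [p', ha]
  have hpi' : (p' i : ℝ) = 1 - (τ - 2 * ε) := by simp [p']
  have hpos (q : unitInterval) (h : (q : ℝ) = 1 - τ ∨ (q : ℝ) = 1 - (τ - ε) ∨
      (q : ℝ) = 1 - (τ - 2 * ε)) (r : Bool) : 0 < bernoulliWeight q r := by
    cases r <;> simp only [bernoulliWeight, if_true, Bool.false_eq_true, if_false] <;>
      rcases h with h | h | h <;> rw [h] <;> linarith
  have hposp (a) (r) : 0 < bernoulliWeight (p a) r := by
    by_cases ha : a = a₀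
    · exact hpos _ (Or.inr (Or.inl (ha ▸ hp₀))) r
    · exact hpos _ (Or.inl (hp₁ a ha)) r
  have hposp' (a) (r) : 0 < bernoulliWeight (p' a) r := by
    by_cases ha : a = i
    · exact hpos _ (Or.inr (Or.inr (ha ▸ hpi'))) r
    · rw [hp' a ha]; exact hposp a r
  have hcv (q : unitInterval) {x : ℝ} (hq : (q : ℝ) = 1 - (τ - x)) (hx : 0 ≤ x) :
      cvar τ (bernoulliMeasure (1 : ℝ) 0 q) = x / τ := by
    rw [cvar_bernoulliMeasure hτ0 (by linarith) q (by linarith), hq]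
    field_simp
    ring
  have hbh := exp_neg_mul_expectedPulls_le alg (τ := τ) (δ := 2 * ε) (by linarith) (by positivity)
    (by linarith) hposp hposp' (hp₁ i hi) hpi' hp' K
  have hregret := mul_sum_min_le_add_expectedCvarRegret alg (τ := τ) (Δ := ε / τ) (p := p)
    (p' := p') (a₀ := a₀) (i := i)
    (fun a ha => by
      rw [hcv (p a) (x := 0) (by rw [hp₁ a ha, sub_zero]) le_rfl, hcv (p a₀) hp₀ hε0]; simp)
    (by
      rw [hcv (p' a₀) (by rw [hp' a₀ hi.symm, hp₀]) hε0, hcv (p' i) hpi' (by positivity)]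
      exact le_of_eq (by ring)) K
  have hinfo : (2 * ε) ^ 2 / ((τ - 2 * ε) * (1 - τ + 2 * ε)) * expectedPulls alg p K i ≤ 1 / 2 := by
    have hT := expectedPulls_nonneg alg p K i
    have hden : τ / 8 ≤ (τ - 2 * ε) * (1 - τ + 2 * ε) := by nlinarith
    calc _ ≤ (2 * ε) ^ 2 / (τ / 8) * expectedPulls alg p K i := by gcongr
      _ = (((A : ℝ) - 1) * expectedPulls alg p K i) / (2 * K) := by
          rw [mul_pow, hε2]; field_simp; norm_num
      _ ≤ 1 / 2 := by
          rw [div_le_iff₀ (by positivity)]; linarith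
  have hexp : 4 / (3 * Real.exp 1) ≤
      2 * ∑ ω, min (outcomeWeight alg p K ω) (outcomeWeight alg p' K ω) := by
    refine le_trans ?_ (le_trans (Real.exp_le_exp.2 (neg_le_neg hinfo)) hbh)
    have h1 : Real.exp 1 * Real.exp (-(1 / 2)) = Real.exp (1 / 2) := by
      rw [← Real.exp_add]; norm_num
    rw [div_le_iff₀ (by positivity)]
    linarith [Real.add_one_le_exp (1 / 2 : ℝ)]
  have hgap : ε / τ * K = s / 8 := by rw [hε]; field_simp
  rw [hgap] at hregret
  have hsum : 2 * (1 / (24 * Real.exp 1) * s) ≤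
      expectedCvarRegret τ K (bernoulliBandit p) alg +
        expectedCvarRegret τ K (bernoulliBandit p') alg := by
    refine le_trans (le_trans (le_of_eq ?_) (mul_le_mul_of_nonneg_left hexp
      (by positivity : 0 ≤ s / 16))) (le_trans (le_of_eq ?_) hregret)
    · field_simp; ring
    · ring
  by_contra! hcon
  linarith [hcon p, hcon p']
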